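/- Let $\mathbb K$ be an algebraically closed field; algebraic groups are affine and reduced and are identified with their groups of $\mathbb K$-points. Let $G$ be a connected algebraic group over $\mathbb K$ and let $(A,+)$ be a commutative algebraic group over $\mathbb K$ on which $G$ acts algebraically by group automorphisms, that is, $A$ carries an action of the group $G$ by group automorphisms, written $(x,a)\mapsto {}^{x}a$, for which the map $G\times A\to A$ is a morphism of varieties. Let $f:G\dashrightarrow A$ be a rational map, given as a morphism of varieties $\operatorname{dom}(f)\to A$ on a dense open subset $\operatorname{dom}(f)\subseteq G$, such that $$f(xy)=f(x)+{}^{x}f(y)\qquad\text{for all } x,y\in G \text{ with } x,\,y,\,xy\in\operatorname{dom}(f).$$ Then there is a morphism of varieties $\widehat f:G\to A$ that agrees with $f$ on $\operatorname{dom}(f)$ and satisfies $$\widehat f(xy)=\widehat f(x)+{}^{x}\widehat f(y)\qquad\text{for all } x,y\in G.$$ -/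

import Mathlib

/-- The structure of an affine algebraic variety (reduced, not necessarily irreducible) on a set `X`
of points over an algebraically closed field `K`: a finitely generated `K`-algebra `K[X]` of
`K`-valued functions on `X` such that the points of `X` are exactly the `K`-algebra homomorphisms
`K[X] → K`, through evaluation. Equivalently, `X` is identified with a Zariski closed subset of some
`Kⁿ` and `K[X]` consists of the restrictions to it of the polynomials. -/
class AffineVariety (K : Type*) [Field K] (X : Type*) where
  /-- The algebra `K[X]` of regular functions. -/
  coordRing : Subalgebra K (X → K)
  fg : coordRing.FG
  eval_bijective : Function.Bijective
    (fun x : X => ((Pi.evalAlgHom K (fun _ : X => K) x).comp coordRing.val : coordRing →ₐ[K] K))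

namespace AffineVariety

/-- The product variety `X × Y`: its regular functions are the polynomials in the regular functions
on `X` and the regular functions on `Y`, so `K[X × Y] = K[X] ⊗ K[Y]`. -/
instance instProd (K : Type*) [Field K] (X Y : Type*) [AffineVariety K X] [AffineVariety K Y] :
    AffineVariety K (X × Y) where
  coordRing :=
    (coordRing (K := K) (X := X)).map (AlgHom.pi fun p : X × Y => Pi.evalAlgHom K _ p.1) ⊔
    (coordRing (K := K) (X := Y)).map (AlgHom.pi fun p : X × Y => Pi.evalAlgHom K _ p.2)
  fg := (fg.map _).sup (fg.map _)
  eval_bijective := by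
    set a : (X → K) →ₐ[K] (X × Y → K) := AlgHom.pi fun p : X × Y => Pi.evalAlgHom K _ p.1
    set b : (Y → K) →ₐ[K] (X × Y → K) := AlgHom.pi fun p : X × Y => Pi.evalAlgHom K _ p.2
    set A := (coordRing (K := K) (X := X)).map a
    set B := (coordRing (K := K) (X := Y)).map b
    have hA : ∀ f ∈ coordRing (K := K) (X := X), a f ∈ A ⊔ B := fun f hf =>
      (le_sup_left : A ≤ A ⊔ B) ⟨f, hf, rfl⟩
    have hB : ∀ f ∈ coordRing (K := K) (X := Y), b f ∈ A ⊔ B := fun f hf =>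
      (le_sup_right : B ≤ A ⊔ B) ⟨f, hf, rfl⟩
    constructor
    · rintro ⟨x, y⟩ ⟨x', y'⟩ h
      refine Prod.ext ?_ ?_
      · refine eval_bijective (K := K).1 (AlgHom.ext fun f => ?_)
        exact DFunLike.congr_fun h (⟨a f.1, hA f.1 f.2⟩ : (A ⊔ B : Subalgebra K (X × Y → K)))
      · refine eval_bijective (K := K).1 (AlgHom.ext fun f => ?_)
        exact DFunLike.congr_fun h (⟨b f.1, hB f.1 f.2⟩ : (A ⊔ B : Subalgebra K (X × Y → K)))
    · intro φ
      obtain ⟨x, hx⟩ := (eval_bijective (K := K) (X := X)).2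
        (φ.comp ((a.comp (coordRing (K := K) (X := X)).val).codRestrict (A ⊔ B)
          fun f => hA f.1 f.2))
      obtain ⟨y, hy⟩ := (eval_bijective (K := K) (X := Y)).2
        (φ.comp ((b.comp (coordRing (K := K) (X := Y)).val).codRestrict (A ⊔ B)
          fun f => hB f.1 f.2))
      refine ⟨(x, y), ?_⟩
      have key : A ⊔ B ≤ (AlgHom.equalizer
          ((Pi.evalAlgHom K (fun _ : X × Y => K) (x, y)).comp (A ⊔ B).val) φ).map (A ⊔ B).val := by
        refine sup_le ?_ ?_
        · rintro _ ⟨f, hf, rfl⟩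
          exact ⟨⟨a f, hA f hf⟩, (AlgHom.mem_equalizer _ _ _).2 (DFunLike.congr_fun hx ⟨f, hf⟩), rfl⟩
        · rintro _ ⟨f, hf, rfl⟩
          exact ⟨⟨b f, hB f hf⟩, (AlgHom.mem_equalizer _ _ _).2 (DFunLike.congr_fun hy ⟨f, hf⟩), rfl⟩
      refine AlgHom.ext fun f => ?_
      obtain ⟨g, hg, hgf⟩ := key f.2
      obtain rfl : g = f := Subtype.ext hgf
      exact hg

/-- The Zariski topology: the open sets are the complements of the common zero sets of families of
regular functions. -/
abbrev zariskiTopology (K : Type*) [Field K] (X : Type*) [AffineVariety K X] : TopologicalSpace X where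
  IsOpen U := ∃ S ⊆ (coordRing (K := K) (X := X) : Set (X → K)), U = {x | ∀ f ∈ S, f x = 0}ᶜ
  isOpen_univ := ⟨{1}, by simp, by ext; simp⟩
  isOpen_inter := by
    rintro _ _ ⟨S, hS, rfl⟩ ⟨T, hT, rfl⟩
    refine ⟨{h | ∃ f ∈ S, ∃ g ∈ T, h = f * g}, ?_, ?_⟩
    · rintro _ ⟨f, hf, g, hg, rfl⟩
      exact mul_mem (hS hf) (hT hg)
    · ext x
      simp only [Set.mem_inter_iff, Set.mem_compl_iff, Set.mem_ofPred_eq, not_forall]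
      constructor
      · rintro ⟨⟨f, hf, hfx⟩, g, hg, hgx⟩
        exact ⟨f * g, ⟨f, hf, g, hg, rfl⟩, mul_ne_zero hfx hgx⟩
      · rintro ⟨_, ⟨f, hf, g, hg, rfl⟩, h⟩
        exact ⟨⟨f, hf, left_ne_zero_of_mul h⟩, g, hg, right_ne_zero_of_mul h⟩
  isOpen_sUnion := by
    intro s hs
    choose! S hS hU using hs
    refine ⟨⋃ U ∈ s, S U, Set.iUnion₂_subset hS, ?_⟩
    ext x
    simp only [Set.mem_sUnion, Set.mem_compl_iff, Set.mem_ofPred_eq, not_forall, Set.mem_iUnion]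
    constructor
    · rintro ⟨U, hUs, hx⟩
      rw [hU U hUs] at hx
      simp only [Set.mem_compl_iff, Set.mem_ofPred_eq, not_forall] at hx
      obtain ⟨f, hf, hfx⟩ := hx
      exact ⟨f, ⟨U, hUs, hf⟩, hfx⟩
    · rintro ⟨f, ⟨U, hUs, hf⟩, hfx⟩
      refine ⟨U, hUs, ?_⟩
      rw [hU U hUs]
      exact fun h => hfx (h f hf)

/-- An algebraic map (morphism) of affine varieties: a map that pulls regular functions back to
regular functions. -/
def IsAlgebraicMap (K : Type*) [Field K] {X Y : Type*} [AffineVariety K X] [AffineVariety K Y]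
    (φ : X → Y) : Prop :=
  ∀ h ∈ coordRing (K := K) (X := Y), h ∘ φ ∈ coordRing (K := K) (X := X)

/-- A function on a subset `U` of `X` (open in all uses) is regular if near every point of `U` it is
a quotient `a / b` of regular functions on `X` whose denominator has no zero there. -/
def IsRegularOn (K : Type*) [Field K] {X : Type*} [AffineVariety K X] (U : Set X) (φ : U → K) :
    Prop :=
  ∀ u : U, ∃ W : Set X, @IsOpen X (zariskiTopology K X) W ∧ u.1 ∈ W ∧ W ⊆ U ∧
    ∃ a ∈ coordRing (K := K) (X := X), ∃ b ∈ coordRing (K := K) (X := X),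
      ∀ v : U, v.1 ∈ W → b v.1 ≠ 0 ∧ φ v = a v.1 / b v.1

/-- A rational map `X ⇢ Y`: a morphism of varieties to `Y` from a dense open subset `dom` of `X`.
The largest possible domain is one allowed choice of `dom`. -/
structure RationalMap (K : Type*) [Field K] (X Y : Type*) [AffineVariety K X]
    [AffineVariety K Y] where
  /-- The domain of definition. -/
  dom : Set X
  isOpen_dom : @IsOpen X (zariskiTopology K X) dom
  dense_dom : @Dense X (zariskiTopology K X) dom
  /-- The values on the domain. -/
  toFun : dom → Y
  regular : ∀ h ∈ coordRing (K := K) (X := Y), IsRegularOn K dom (h ∘ toFun)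

/-- `G` is an algebraic group (affine and reduced): its multiplication and its inversion are
algebraic maps. -/
class IsAlgebraicGroup (K : Type*) [Field K] (G : Type*) [Group G] [AffineVariety K G] : Prop where
  mul : IsAlgebraicMap K (fun p : G × G => p.1 * p.2)
  inv : IsAlgebraicMap K (fun x : G => x⁻¹)

/-- `H` is a commutative algebraic group (affine and reduced), written additively. -/
class IsAlgebraicAddCommGroup (K : Type*) [Field K] (H : Type*) [AddCommGroup H]
    [AffineVariety K H] : Prop where
  add : IsAlgebraicMap K (fun p : H × H => p.1 + p.2)
  neg : IsAlgebraicMap K (fun x : H => -x)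

/-- `G` is connected in its Zariski topology. -/
def IsZariskiConnected (K : Type*) [Field K] (G : Type*) [AffineVariety K G] : Prop :=
  @ConnectedSpace G (zariskiTopology K G)

end AffineVariety

/-! An extension `F` must satisfy `F x = f (x * c) - x • f c` whenever `c` and `x * c` lie in the
domain, so this formula is taken as its definition. Such `c` exist because finitely many translates
of a dense open set meet (`exists_forall_mul_mem`). The same fact supplies the auxiliary points
showing that the value does not depend on `c` and that `F` is a crossed homomorphism
(`exists_extension_of_partial_crossedHom`).

For fixed `c` the formula is regular in `x` near every point of the open set where `x * c` is in the
domain, and these sets cover `G`. By the Nullstellensatz, a function regular near every point lies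
in the coordinate ring (`mem_coordRing_of_forall_mem_regularAt`). -/

/-- A proper ideal of a finitely generated algebra over an algebraically closed field `K` is killed
by some `K`-point. -/
theorem Ideal.exists_algHom_eq_zero_of_ne_top {K R : Type*} [Field K] [IsAlgClosed K] [CommRing R]
    [Algebra K R] [Algebra.FiniteType K R] {I : Ideal R} (hI : I ≠ ⊤) :
    ∃ φ : R →ₐ[K] K, ∀ b ∈ I, φ b = 0 := by
  obtain ⟨M, hM, hIM⟩ := I.exists_le_maximal hI
  let _ := Ideal.Quotient.field M
  have : Algebra.FiniteType K (R ⧸ M) :=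
    .of_surjective (Ideal.Quotient.mkₐ K M) (Ideal.Quotient.mkₐ_surjective K M)
  -- Zariski's lemma; as `K` is algebraically closed, the residue field is then `K` itself.
  have : Module.Finite K (R ⧸ M) := finite_of_finite_type_of_isJacobsonRing K _
  let e : K ≃ₐ[K] (R ⧸ M) :=
    AlgEquiv.ofBijective (Algebra.ofId K _) IsAlgClosed.algebraMap_bijective_of_isIntegral
  refine ⟨e.symm.toAlgHom.comp (Ideal.Quotient.mkₐ K M), fun b hb => ?_⟩
  have : Ideal.Quotient.mkₐ K M b = 0 := Ideal.Quotient.eq_zero_iff_mem.2 (hIM hb)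
  rw [AlgHom.comp_apply, this, map_zero]

/-! ### Morphisms and local regularity -/

namespace AffineVariety

variable {K : Type*} [Field K] {X Y Z : Type*} [AffineVariety K X] [AffineVariety K Y]
  [AffineVariety K Z]

/-- If regular functions on `X` and `Y` pull back into a subalgebra of functions on a set `S`, then
so do the regular functions on `X × Y`. -/
theorem comp_prodMk_mem {S : Type*} (R : Subalgebra K (S → K)) {φ : S → X} {ψ : S → Y}
    (hφ : ∀ h ∈ coordRing (K := K) (X := X), h ∘ φ ∈ R)
    (hψ : ∀ h ∈ coordRing (K := K) (X := Y), h ∘ ψ ∈ R)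
    {h : X × Y → K} (hh : h ∈ coordRing (K := K) (X := X × Y)) :
    (fun s => h (φ s, ψ s)) ∈ R := by
  have key : coordRing (K := K) (X := X × Y) ≤
      R.comap (AlgHom.pi fun s : S => Pi.evalAlgHom K (fun _ : X × Y => K) (φ s, ψ s)) := by
    refine sup_le ?_ ?_
    · rintro _ ⟨g, hg, rfl⟩
      exact hφ g hg
    · rintro _ ⟨g, hg, rfl⟩
      exact hψ g hg
  exact key hh

theorem const_mem_coordRing (c : K) : (fun _ => c) ∈ coordRing (K := K) (X := X) :=
  (coordRing (K := K) (X := X)).algebraMap_mem c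

theorem IsAlgebraicMap.prodMk {φ : Z → X} {ψ : Z → Y} (hφ : IsAlgebraicMap K φ)
    (hψ : IsAlgebraicMap K ψ) : IsAlgebraicMap K fun z => (φ z, ψ z) :=
  fun _ hh => comp_prodMk_mem _ hφ hψ hh

theorem IsAlgebraicMap.id : IsAlgebraicMap K (fun x : X => x) := fun _ hh => hh

theorem IsAlgebraicMap.const (y : Y) : IsAlgebraicMap K (fun _ : X => y) :=
  fun h _ => const_mem_coordRing (h y)

theorem IsAlgebraicMap.comp {φ : Y → Z} {ψ : X → Y} (hφ : IsAlgebraicMap K φ)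
    (hψ : IsAlgebraicMap K ψ) : IsAlgebraicMap K (fun x => φ (ψ x)) :=
  fun h hh => hψ _ (hφ h hh)

theorem IsAlgebraicMap.continuous {φ : X → Y} (hφ : IsAlgebraicMap K φ) :
    @Continuous X Y (zariskiTopology K X) (zariskiTopology K Y) φ := by
  let _ := zariskiTopology K X
  let _ := zariskiTopology K Y
  refine ⟨?_⟩
  rintro _ ⟨S, hS, rfl⟩
  refine ⟨(· ∘ φ) '' S, ?_, ?_⟩
  · rintro _ ⟨g, hg, rfl⟩
    exact hφ g (hS hg)
  · ext x
    simp

/-- A neighbourhood of a point contains a principal neighbourhood. -/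
theorem exists_ne_zero_of_isOpen {W : Set X} (hW : @IsOpen X (zariskiTopology K X) W) {x : X}
    (hx : x ∈ W) :
    ∃ b ∈ coordRing (K := K) (X := X), b x ≠ 0 ∧ ∀ y, b y ≠ 0 → y ∈ W := by
  obtain ⟨S, hS, rfl⟩ := hW
  simp only [Set.mem_compl_iff, Set.mem_ofPred_eq, not_forall] at hx ⊢
  obtain ⟨b, hb, hbx⟩ := hx
  exact ⟨b, hS hb, hbx, fun y hy => ⟨b, hb, hy⟩⟩

/-- The functions on `X` that are regular near the point `x`. -/
def regularAt (K : Type*) [Field K] {X : Type*} [AffineVariety K X] (x : X) :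
    Subalgebra K (X → K) where
  -- Where `b` vanishes, `φ` is unconstrained, so total functions with arbitrary values away from
  -- `x` can stand for germs at `x`.
  carrier := {φ | ∃ b ∈ coordRing (K := K) (X := X), b x ≠ 0 ∧ b * φ ∈ coordRing (K := K) (X := X)}
  mul_mem' := by
    rintro φ ψ ⟨b, hb, hbx, hφ⟩ ⟨c, hc, hcx, hψ⟩
    refine ⟨b * c, mul_mem hb hc, mul_ne_zero hbx hcx, ?_⟩
    rw [mul_mul_mul_comm]
    exact mul_mem hφ hψ
  add_mem' := by
    rintro φ ψ ⟨b, hb, hbx, hφ⟩ ⟨c, hc, hcx, hψ⟩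
    refine ⟨b * c, mul_mem hb hc, mul_ne_zero hbx hcx, ?_⟩
    have : b * c * (φ + ψ) = c * (b * φ) + b * (c * ψ) := by ring
    rw [this]
    exact add_mem (mul_mem hc hφ) (mul_mem hb hψ)
  algebraMap_mem' r :=
    ⟨1, one_mem _, one_ne_zero, by rw [one_mul]; exact Subalgebra.algebraMap_mem _ r⟩

theorem coordRing_le_regularAt (x : X) : coordRing (K := K) (X := X) ≤ regularAt K x :=
  fun φ hφ => ⟨1, one_mem _, one_ne_zero, by rwa [one_mul]⟩

/-- Regularity at a point is local. -/
theorem mem_regularAt_congr {W : Set X} (hW : @IsOpen X (zariskiTopology K X) W) {x : X}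
    (hx : x ∈ W) {φ ψ : X → K} (h : ∀ y ∈ W, φ y = ψ y) (hψ : ψ ∈ regularAt K x) :
    φ ∈ regularAt K x := by
  obtain ⟨c, hc, hcx, hcW⟩ := exists_ne_zero_of_isOpen hW hx
  obtain ⟨b, hb, hbx, hψ⟩ := hψ
  refine ⟨c * b, mul_mem hc hb, mul_ne_zero hcx hbx, ?_⟩
  have : c * b * φ = c * (b * ψ) := by
    ext y
    simp only [Pi.mul_apply, mul_assoc]
    by_cases hy : c y = 0
    · simp [hy]
    · rw [h y (hcW y hy)]
  rw [this]
  exact mul_mem hc hψ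

/-- A quotient of regular functions is regular wherever the denominator does not vanish. -/
theorem div_mem_regularAt {a b : X → K} (ha : a ∈ coordRing (K := K) (X := X))
    (hb : b ∈ coordRing (K := K) (X := X)) {x : X} (hx : b x ≠ 0) : a / b ∈ regularAt K x := by
  -- A single `b` would not do: `b * (a / b) = a` can fail at zeros of `b`, where division returns
  -- `0`.
  refine ⟨b * b, mul_mem hb hb, mul_ne_zero hx hx, ?_⟩
  have : b * b * (a / b) = b * a := by
    ext y
    simp only [Pi.mul_apply, Pi.div_apply]
    by_cases hy : b y = 0
    · simp [hy]
    · field_simp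
  rw [this]
  exact mul_mem hb ha

theorem IsRegularOn.mem_regularAt {U : Set X} {φ : U → K} (hφ : IsRegularOn K U φ) {ψ : X → K}
    (h : ∀ u : U, ψ u = φ u) {x : X} (hx : x ∈ U) : ψ ∈ regularAt K x := by
  obtain ⟨W, hW, hxW, hWU, a, ha, b, hb, hab⟩ := hφ ⟨x, hx⟩
  refine mem_regularAt_congr hW hxW (fun y hy => ?_) (div_mem_regularAt ha hb (hab ⟨x, hx⟩ hxW).1)
  rw [h ⟨y, hWU hy⟩, (hab ⟨y, hWU hy⟩ hy).2, Pi.div_apply]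

theorem IsAlgebraicMap.comp_mem_regularAt {φ : X → Y} (hφ : IsAlgebraicMap K φ) {x : X}
    {ψ : Y → K} (hψ : ψ ∈ regularAt K (φ x)) : (fun y => ψ (φ y)) ∈ regularAt K x := by
  obtain ⟨b, hb, hbx, hψ⟩ := hψ
  exact ⟨b ∘ φ, hφ b hb, hbx, hφ _ hψ⟩

/-- Weak Nullstellensatz: an ideal of `K[X]` without common zeros is the unit ideal. -/
theorem ideal_eq_top_of_forall_exists_ne_zero [IsAlgClosed K]
    (I : Ideal (coordRing (K := K) (X := X))) (hI : ∀ x : X, ∃ b ∈ I, b.1 x ≠ 0) : I = ⊤ := by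
  by_contra hne
  have : Algebra.FiniteType K (coordRing (K := K) (X := X)) :=
    (coordRing (K := K) (X := X)).fg_iff_finiteType.1 fg
  obtain ⟨φ, hφ⟩ := Ideal.exists_algHom_eq_zero_of_ne_top (K := K) hne
  obtain ⟨x, rfl⟩ := (eval_bijective (K := K) (X := X)).2 φ
  obtain ⟨b, hb, hbx⟩ := hI x
  exact hbx (hφ b hb)

/-- A function that is regular near every point is regular. -/
theorem mem_coordRing_of_forall_mem_regularAt [IsAlgClosed K] {φ : X → K}
    (hφ : ∀ x, φ ∈ regularAt K x) : φ ∈ coordRing (K := K) (X := X) := by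
  -- The ideal of denominators of `φ`; local regularity says that it has no common zero.
  let I : Ideal (coordRing (K := K) (X := X)) :=
    { carrier := {b | b.1 * φ ∈ coordRing (K := K) (X := X)}
      add_mem' := fun {b c} hb hc => by
        change (b.1 + c.1) * φ ∈ coordRing (K := K) (X := X)
        rw [add_mul]
        exact add_mem hb hc
      zero_mem' := by
        change (0 : X → K) * φ ∈ coordRing (K := K) (X := X)
        rw [zero_mul]
        exact zero_mem _
      smul_mem' := fun c b hb => by
        change c.1 * b.1 * φ ∈ coordRing (K := K) (X := X)
        rw [mul_assoc]
        exact mul_mem c.2 hb }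
  have hI : I = ⊤ := ideal_eq_top_of_forall_exists_ne_zero I fun x => by
    obtain ⟨b, hb, hbx, h⟩ := hφ x
    exact ⟨⟨b, hb⟩, h, hbx⟩
  have h1 : (1 : X → K) * φ ∈ coordRing (K := K) (X := X) := (Ideal.eq_top_iff_one I).1 hI
  rwa [one_mul] at h1

/-! ### Translates in an algebraic group -/

section Group

variable {G : Type*} [Group G] [AffineVariety K G] [IsAlgebraicGroup K G]

theorem isAlgebraicMap_mul_left (g : G) : IsAlgebraicMap K (fun x : G => g * x) :=
  (IsAlgebraicGroup.mul (K := K) (G := G)).comp ((IsAlgebraicMap.const g).prodMk .id)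

theorem isAlgebraicMap_mul_right (g : G) : IsAlgebraicMap K (fun x : G => x * g) :=
  (IsAlgebraicGroup.mul (K := K) (G := G)).comp (IsAlgebraicMap.id.prodMk (.const g))

/-- Left translation by `g`, as a homeomorphism. -/
def mulLeftHomeomorph (K : Type*) [Field K] {G : Type*} [Group G] [AffineVariety K G]
    [IsAlgebraicGroup K G] (g : G) :
    @Homeomorph G G (zariskiTopology K G) (zariskiTopology K G) :=
  letI := zariskiTopology K G
  { Equiv.mulLeft g with
    continuous_toFun := (isAlgebraicMap_mul_left (K := K) g).continuous
    continuous_invFun := (isAlgebraicMap_mul_left (K := K) g⁻¹).continuous }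

/-- Finitely many left translates of a dense open set have a common point. -/
theorem exists_forall_mul_mem {U : Set G} (hU : @IsOpen G (zariskiTopology K G) U)
    (hd : @Dense G (zariskiTopology K G) U) (T : Finset G) : ∃ c, ∀ g ∈ T, g * c ∈ U := by
  let _ := zariskiTopology K G
  have key : IsOpen {c | ∀ g ∈ T, g * c ∈ U} ∧ Dense {c | ∀ g ∈ T, g * c ∈ U} := by
    classical
    induction T using Finset.induction_on with
    | empty => simp
    | insert g T _ ih =>
      have : {c | ∀ g' ∈ insert g T, g' * c ∈ U} =
          (mulLeftHomeomorph K g ⁻¹' U) ∩ {c | ∀ g' ∈ T, g' * c ∈ U} := by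
        ext c
        exact Finset.forall_mem_insert g T fun g' => g' * c ∈ U
      rw [this]
      have ho : IsOpen (mulLeftHomeomorph K g ⁻¹' U) :=
        hU.preimage (mulLeftHomeomorph K g).continuous
      have hd' : Dense (mulLeftHomeomorph K g ⁻¹' U) :=
        hd.preimage (mulLeftHomeomorph K g).isOpenMap
      exact ⟨ho.inter ih.1, hd'.inter_of_isOpen_left ih.2 ho⟩
  have : Nonempty G := ⟨1⟩
  exact key.2.nonempty

end Group

end AffineVariety

/-- A partial crossed homomorphism on a set `U`, finitely many left translates of which always have
a common point, extends to a crossed homomorphism `F`, determined by `F x = f (x * c) - x • f c`. -/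
theorem exists_extension_of_partial_crossedHom {G H : Type*} [Group G] [AddCommGroup H]
    [DistribMulAction G H] {U : Set G} (hU : ∀ T : Finset G, ∃ c, ∀ g ∈ T, g * c ∈ U) {f : G → H}
    (hf : ∀ x y, x ∈ U → y ∈ U → x * y ∈ U → f (x * y) = f x + x • f y) :
    ∃ F : G → H, (∀ x c, c ∈ U → x * c ∈ U → F x = f (x * c) - x • f c) ∧
      (∀ x ∈ U, F x = f x) ∧ ∀ x y, F (x * y) = F x + x • F y := by
  classical
  -- Expand `f g` and `f (x * g)` along `g = c * (c⁻¹ * g)`: the two contributions of `f (c⁻¹ * g)`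
  -- cancel.
  have change : ∀ x c g, c ∈ U → x * c ∈ U → c⁻¹ * g ∈ U → g ∈ U → x * g ∈ U →
      f (x * c) - x • f c = f (x * g) - x • f g := by
    intro x c g hc hxc he hg hxg
    have h₁ := hf c (c⁻¹ * g) hc he (by simpa using hg)
    have h₂ := hf (x * c) (c⁻¹ * g) hxc he (by simpa [mul_assoc] using hxg)
    rw [mul_inv_cancel_left] at h₁
    rw [mul_assoc x, mul_inv_cancel_left] at h₂
    rw [h₁, h₂, smul_add, smul_smul]
    abel
  have indep : ∀ x c d, c ∈ U → x * c ∈ U → d ∈ U → x * d ∈ U →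
      f (x * c) - x • f c = f (x * d) - x • f d := by
    intro x c d hc hxc hd hxd
    -- A generic `g` to which both `c` and `d` can be changed; `c⁻¹ * d` itself need not lie in `U`.
    obtain ⟨g, hg⟩ := hU {c⁻¹, d⁻¹, 1, x}
    simp only [Finset.mem_insert, Finset.mem_singleton, forall_eq_or_imp, forall_eq, one_mul] at hg
    obtain ⟨h₁, h₂, h₃, h₄⟩ := hg
    rw [change x c g hc hxc h₁ h₃ h₄, change x d g hd hxd h₂ h₃ h₄]
  have hex : ∀ x, ∃ c, c ∈ U ∧ x * c ∈ U := fun x => by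
    obtain ⟨c, hc⟩ := hU {1, x}
    exact ⟨c, by simpa using hc 1 (by simp), hc x (by simp)⟩
  choose c hc hxc using hex
  have key : ∀ x d, d ∈ U → x * d ∈ U → f (x * c x) - x • f (c x) = f (x * d) - x • f d :=
    fun x d => indep x (c x) d (hc x) (hxc x)
  refine ⟨fun x => f (x * c x) - x • f (c x), key, fun x hx => ?_, fun x y => ?_⟩
  · simp only [hf x (c x) hx (hc x) (hxc x), add_sub_cancel_right]
  -- Computing `F x` with `y * d` and `F y` with `d` makes the terms in `f (y * d)` cancel.
  · obtain ⟨d, hd⟩ := hU {1, y, x * y}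
    simp only [Finset.mem_insert, Finset.mem_singleton, forall_eq_or_imp, forall_eq, one_mul] at hd
    obtain ⟨h₁, h₂, h₃⟩ := hd
    simp only
    rw [key (x * y) d h₁ h₃, key y d h₁ h₂, key x (y * d) h₂ (by rwa [← mul_assoc]), smul_sub,
      smul_smul, mul_assoc]
    abel

/-- `DistribMulAction G H` is an action of the group `G` on `H` by group automorphisms. -/
theorem mainTheorem7 {K : Type*} [Field K] [IsAlgClosed K]
    {G : Type*} [Group G] [AffineVariety K G] [AffineVariety.IsAlgebraicGroup K G]
    (hG : AffineVariety.IsZariskiConnected K G)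
    {H : Type*} [AddCommGroup H] [AffineVariety K H] [AffineVariety.IsAlgebraicAddCommGroup K H]
    [DistribMulAction G H]
    (hρ : AffineVariety.IsAlgebraicMap K (fun p : G × H => p.1 • p.2))
    (f : AffineVariety.RationalMap K G H)
    (hf : ∀ (x y : G) (hx : x ∈ f.dom) (hy : y ∈ f.dom) (hxy : x * y ∈ f.dom),
      f.toFun ⟨x * y, hxy⟩ = f.toFun ⟨x, hx⟩ + x • f.toFun ⟨y, hy⟩) :
    ∃ F : G → H, AffineVariety.IsAlgebraicMap K F ∧
      (∀ x : f.dom, F x = f.toFun x) ∧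
      ∀ x y : G, F (x * y) = F x + x • F y := by
  classical
  let f' : G → H := fun x => if hx : x ∈ f.dom then f.toFun ⟨x, hx⟩ else 0
  have hf' : ∀ u : f.dom, f' u = f.toFun u := fun u => dif_pos u.2
  obtain ⟨F, hF, hFdom, hFmul⟩ := exists_extension_of_partial_crossedHom (f := f')
    (AffineVariety.exists_forall_mul_mem f.isOpen_dom f.dense_dom) (fun x y hx hy hxy => by
      rw [hf' ⟨x, hx⟩, hf' ⟨y, hy⟩, hf' ⟨x * y, hxy⟩]
      exact hf x y hx hy hxy)
  refine ⟨F, fun h hh => AffineVariety.mem_coordRing_of_forall_mem_regularAt fun x => ?_,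
    fun x => (hFdom x x.2).trans (hf' x), hFmul⟩
  obtain ⟨c, hc⟩ := AffineVariety.exists_forall_mul_mem (K := K) f.isOpen_dom f.dense_dom {1, x}
  have hcU : c ∈ f.dom := by simpa using hc 1 (by simp)
  have hxc : x * c ∈ f.dom := hc x (by simp)
  let _ := AffineVariety.zariskiTopology K G
  have hright := AffineVariety.isAlgebraicMap_mul_right (K := K) c
  -- With `c` fixed, the formula for `F` holds on a whole neighbourhood of `x`, which avoids the
  -- zero values of `f'` off the domain.
  refine AffineVariety.mem_regularAt_congr (W := {y | y * c ∈ f.dom})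
    (ψ := fun y => h (f' (y * c) + y • (-f' c))) (f.isOpen_dom.preimage hright.continuous) hxc
    (fun y hy => by simp [hF y c hcU hy, sub_eq_add_neg]) ?_
  refine AffineVariety.comp_prodMk_mem _ (fun k hk => ?_) (fun k hk => ?_)
    (AffineVariety.IsAlgebraicAddCommGroup.add (K := K) h hh)
  · exact hright.comp_mem_regularAt ((f.regular k hk).mem_regularAt (ψ := k ∘ f')
      (fun u => congrArg k (hf' u)) hxc)
  · exact AffineVariety.coordRing_le_regularAt x
      (hρ.comp (AffineVariety.IsAlgebraicMap.id.prodMk (.const (-f' c))) k hk)
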